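/- Let $X$ be a topological space, $X=U\cup V$, where $U,V\subset X$ are open and path-connected, and suppose that $U\cap V$ has exactly $m+1$ path components $A_0,A_1,\dots,A_m$. Assume that $A_0$ is open in $X$ (for example, that $X$ is locally path-connected) or that $X$ is Hausdorff. Choose $a_i\in A_i$ for $i=0,\dots,m$, put $b=a_0$, and for $k=1,\dots,m$ let $p_k$ be a path in $U$ and $q_k$ a path in $V$ from $b$ to $a_k$. Products of paths follow the first path first, $\pi_1$ is multiplied accordingly, and for a path $p$ from $b$ to $a$ the isomorphism $\pi(p)\colon\pi_1(\cdot,a)\to\pi_1(\cdot,b)$ is $[r]\mapsto[p\cdot r\cdot p^{-1}]$. Let $U'$ be a disjoint copy of $U$, and let $C$ be the quotient space of the disjoint union $U'\sqcup V$ obtained by identifying the copy $A_0'\subset U'$ of $A_0$ with $A_0\subset V$; let $\sigma\colon C\to X$ be the obvious map, and denote by $b$ also the common image of $b\in V$ and of its copy $b'\in U'$ in $C$. For $k=1,\dots,m$ let $i_k\colon A_k\to V\to C$ be the inclusion, let $\widehat\imath_k\colon A_k\to U'\to C$ be the inclusion of the copy of $A_k$ in $U'$, let $p_k'$ be the copy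 of $p_k$ in $U'$, and put $$\theta_k=\pi(q_k)\circ(i_k)_*,\qquad \widehat\theta_k=\pi(p_k')\circ(\widehat\imath_k)_*\colon\ \pi_1(A_k,a_k)\longrightarrow\pi_1(C,b).$$ Let $F$ be the free group with $m$ generators $t_1,\dots,t_m$, and let $N$ be the normal closure in the free product $\pi_1(C,b)*F$ of the elements $\widehat\theta_k(\alpha)\bigl(t_k\,\theta_k(\alpha)\,t_k^{-1}\bigr)^{-1}$ with $1\le k\le m$ and $\alpha\in\pi_1(A_k,a_k)$. Then there is an isomorphism $$\bigl(\pi_1(C,b)*F\bigr)/N\ \longrightarrow\ \pi_1(X,b)$$ such that the corresponding homomorphism $\pi_1(C,b)*F\to\pi_1(X,b)$ is equal to $\sigma_*$ on $\pi_1(C,b)$ and maps $t_k$ to the class of the loop $p_k\cdot q_k^{-1}$ for every $k$. -/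

import Mathlib

noncomputable section

namespace VanKampen

/-- The fundamental group `π₁(X, x)` with the usual multiplication of homotopy classes of loops,
`[γ] * [δ] = [γ · δ]`, where `γ · δ` follows first `γ` and then `δ`. Mathlib's `FundamentalGroup`
multiplies in the opposite order (`FundamentalGroup.mul_def`), hence the `ᵐᵒᵖ`. -/
abbrev PiOne (X : Type*) [TopologicalSpace X] (x : X) : Type _ :=
  (FundamentalGroup X x)ᵐᵒᵖ

section General

variable {X Y : Type*} [TopologicalSpace X] [TopologicalSpace Y]

/-- The homotopy class in `π₁(X, x)` of a loop based at `x`. -/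
def loopClass {x : X} (γ : Path x x) : PiOne X x :=
  MulOpposite.op (FundamentalGroup.fromPath (Path.Homotopic.Quotient.mk γ))

theorem loopClass_trans {x : X} (γ δ : Path x x) :
    loopClass (γ.trans δ) = loopClass γ * loopClass δ := rfl

/-- The homomorphism `f_* : π₁(X, x) → π₁(Y, f x)` induced by a continuous map `f`. -/
def piOneMap (f : C(X, Y)) (x : X) : PiOne X x →* PiOne Y (f x) :=
  MonoidHom.op (FundamentalGroup.map f x)

theorem piOneMap_loopClass (f : C(X, Y)) {x : X} (γ : Path x x) :
    piOneMap f x (loopClass γ) = loopClass (γ.map f.continuous) := rfl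

/-- The change of base point `π(p) : π₁(X, a) → π₁(X, b)`, `[r] ↦ [p · r · p⁻¹]`,
along a path `p` from `b` to `a`. -/
def changeBase {b a : X} (p : Path b a) : PiOne X a →* PiOne X b :=
  MonoidHom.op (FundamentalGroup.fundamentalGroupMulEquivOfPath p).symm.toMonoidHom

theorem changeBase_loopClass {b a : X} (p : Path b a) (r : Path a a) :
    changeBase p (loopClass r) = loopClass (p.trans (r.trans p.symm)) := rfl

end General

section Gluing

variable {X : Type*} [TopologicalSpace X]

/-- The map from the disjoint union of (a copy of) `U` and `V` to `X`. -/
def sumToX (U V : Set X) : U ⊕ V → X :=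
  Sum.elim Subtype.val Subtype.val

/-- The equivalence relation on the disjoint union `U ⊔ V` that identifies the two copies of every
point of `B` and makes no other identification. -/
def glueSetoid (U V B : Set X) : Setoid (U ⊕ V) where
  r y z := y = z ∨ (sumToX U V y = sumToX U V z ∧ sumToX U V y ∈ B)
  iseqv :=
    { refl := fun _ => Or.inl rfl
      symm := by
        rintro y z (h | ⟨h, hB⟩)
        · exact Or.inl h.symm
        · exact Or.inr ⟨h.symm, h ▸ hB⟩
      trans := by
        rintro x y z (h | ⟨h, hB⟩) (h' | ⟨h', hB'⟩)
        · exact Or.inl (h.trans h')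
        · exact Or.inr ⟨by rw [h, h'], h ▸ hB'⟩
        · exact Or.inr ⟨by rw [h, h'], hB⟩
        · exact Or.inr ⟨h.trans h', hB⟩ }

/-- The space obtained from the disjoint union of a copy `U'` of `U` and of `V` by identifying the
copy of `B` in `U'` with `B ⊆ V`, with the quotient topology. -/
def Glue (U V B : Set X) : Type _ :=
  Quotient (glueSetoid U V B)

instance (U V B : Set X) : TopologicalSpace (Glue U V B) :=
  inferInstanceAs (TopologicalSpace (Quotient (glueSetoid U V B)))

/-- The canonical map `U → U' → C`. -/
def glueInl (U V B : Set X) : C(U, Glue U V B) where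
  toFun u := Quotient.mk (glueSetoid U V B) (Sum.inl u)
  continuous_toFun := continuous_quotient_mk'.comp continuous_inl

/-- The canonical map `V → C`. -/
def glueInr (U V B : Set X) : C(V, Glue U V B) where
  toFun v := Quotient.mk (glueSetoid U V B) (Sum.inr v)
  continuous_toFun := continuous_quotient_mk'.comp continuous_inr

theorem glueInl_eq_glueInr {U V B : Set X} {b : X} (hU : b ∈ U) (hV : b ∈ V) (hB : b ∈ B) :
    glueInr U V B ⟨b, hV⟩ = glueInl U V B ⟨b, hU⟩ :=
  Quotient.sound (Or.inr ⟨rfl, hB⟩)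

/-- The obvious map `σ : C → X`. -/
def glueToX (U V B : Set X) : C(Glue U V B, X) where
  toFun := Quotient.lift (sumToX U V) (by
    rintro y z (h | ⟨h, -⟩)
    · rw [h]
    · exact h)
  continuous_toFun :=
    (continuous_subtype_val.sumElim continuous_subtype_val).quotient_lift _

/-- The homomorphism `σ_* : π₁(C, b) → π₁(X, b)`; the base point of `C` is the image of `b ∈ V`. -/
def sigmaStar (U V B : Set X) {b : X} (hV : b ∈ V) :
    PiOne (Glue U V B) (glueInr U V B ⟨b, hV⟩) →* PiOne X b :=
  piOneMap (glueToX U V B) (glueInr U V B ⟨b, hV⟩)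

/-- The homomorphism `θ = π(q) ∘ i_* : π₁(A, a) → π₁(C, b)`, where `i : A → V → C` is the
inclusion and `q` is a path from `b` to `a` in `V`. -/
def theta (U V B : Set X) {A : Set X} {b a : X} (hV : b ∈ V) (hAV : A ⊆ V) (ha : a ∈ A)
    (q : Path (⟨b, hV⟩ : V) ⟨a, hAV ha⟩) :
    PiOne A ⟨a, ha⟩ →* PiOne (Glue U V B) (glueInr U V B ⟨b, hV⟩) :=
  (changeBase (q.map (glueInr U V B).continuous)).comp
    (piOneMap ((glueInr U V B).comp (ContinuousMap.inclusion hAV)) ⟨a, ha⟩)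

/-- The homomorphism `θ̂ = π(p') ∘ î_* : π₁(A, a) → π₁(C, b)`, where `î : A → A' ⊆ U' → C` is the
inclusion of the copy of `A` in `U'` and `p'` is the copy in `U'` of a path `p` from `b` to `a`
in `U`; the points `b ∈ V` and `b' ∈ U'` coincide in `C`, since `b ∈ B`. -/
def thetaHat (U V B : Set X) {A : Set X} {b a : X} (hU : b ∈ U) (hV : b ∈ V) (hB : b ∈ B)
    (hAU : A ⊆ U) (ha : a ∈ A) (p : Path (⟨b, hU⟩ : U) ⟨a, hAU ha⟩) :
    PiOne A ⟨a, ha⟩ →* PiOne (Glue U V B) (glueInr U V B ⟨b, hV⟩) :=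
  (changeBase ((p.map (glueInl U V B).continuous).cast (glueInl_eq_glueInr hU hV hB) rfl)).comp
    (piOneMap ((glueInl U V B).comp (ContinuousMap.inclusion hAU)) ⟨a, ha⟩)

end Gluing

/-- The path component of `U ∩ V` that contains the point `a ∈ U ∩ V`. -/
abbrev comp {X : Type*} [TopologicalSpace X] (U V : Set X) (a : X) : Set X :=
  pathComponentIn (U ∩ V) a

theorem comp_subset_left {X : Type*} [TopologicalSpace X] {U V : Set X} {a : X} :
    comp U V a ⊆ U :=
  pathComponentIn_subset.trans Set.inter_subset_left

theorem comp_subset_right {X : Type*} [TopologicalSpace X] {U V : Set X} {a : X} :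
    comp U V a ⊆ V :=
  pathComponentIn_subset.trans Set.inter_subset_right

theorem mem_comp {X : Type*} [TopologicalSpace X] {U V : Set X} {a : X} (ha : a ∈ U ∩ V) :
    a ∈ comp U V a :=
  mem_pathComponentIn_self ha

/-- Given homomorphisms `φ k, ψ k : H k → G`, the elements `φ k α * (t k * ψ k α * (t k)⁻¹)⁻¹` of
the free product of `G` and the free group on generators `t k`: to kill all of them is to impose
the relations `φ k α = t k * ψ k α * (t k)⁻¹`. -/
def hnnRelators {ι : Type*} {G : Type*} [Group G] {H : ι → Type*} [∀ k, Group (H k)]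
    (φ ψ : ∀ k, H k →* G) : Set (Monoid.Coprod G (FreeGroup ι)) :=
  {w | ∃ (k : ι) (α : H k), w =
    Monoid.Coprod.inl (φ k α) *
      (Monoid.Coprod.inr (FreeGroup.of k) * Monoid.Coprod.inl (ψ k α) *
        (Monoid.Coprod.inr (FreeGroup.of k))⁻¹)⁻¹}

/-- The free product of `G` and the free group on generators `t k`, with the relations
`φ k α = t k * ψ k α * (t k)⁻¹` imposed for all `k` and all `α`. -/
abbrev HNNQuotient {ι : Type*} {G : Type*} [Group G] {H : ι → Type*} [∀ k, Group (H k)]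
    (φ ψ : ∀ k, H k →* G) : Type _ :=
  Monoid.Coprod G (FreeGroup ι) ⧸ Subgroup.normalClosure (hnnRelators φ ψ)

/-- The canonical homomorphism from the free product onto its quotient. -/
abbrev HNNQuotient.proj {ι : Type*} {G : Type*} [Group G] {H : ι → Type*} [∀ k, Group (H k)]
    {φ ψ : ∀ k, H k →* G} : Monoid.Coprod G (FreeGroup ι) →* HNNQuotient φ ψ :=
  QuotientGroup.mk' (Subgroup.normalClosure (hnnRelators φ ψ))

end VanKampen

end

/-!
Homomorphisms `π₁(X, b) → G` are the restrictions to loops of cocycles, that is, of `G`-valued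
functors on the fundamental groupoid of `X`. Cocycles on `U` and `V` that agree on `U ∩ V` come
from a cocycle on `X`: bisect a path until its pieces lie in `U` or in `V` and multiply the values
of the pieces; bisecting a homotopy in the same way shows that the product depends only on the
homotopy class.

A homomorphism `π₁(C, b) → G` comes from a cocycle on `C`, which restricts to cocycles on `U` and
`V` that agree on `A₀`. If elements `τ k` of `G` satisfy the defining relations together with that
homomorphism, then on each of the other components `A k` the two cocycles become equal after the
one on `U` is twisted by a function `δ` with `δ (a k) = c_U(p k)⁻¹ * τ k * c_V(q k)`. So the
twisted cocycles come from a cocycle on `X`, and its homomorphism `π₁(X, b) → G` takes the value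
`τ k` on the class of `p k · (q k)⁻¹`. Hence `π₁(X, b)` has the universal property of the quotient.

If `A₀` is not open in `X`, then the images of `U'` and `V` in `C` need not be open, but when `X` is
Hausdorff their preimages under paths in `C` are, which is all that bisection requires.
-/

noncomputable section

namespace VanKampen

open Set Filter Topology Function
open scoped unitInterval

/-! ### Bisection -/

section Bisection

variable {X : Type*} [TopologicalSpace X]

/-- The contraction `t ↦ (e + t) / 2` of the unit interval towards `e`. The affine
parametrizations of the lower and the upper half of the interval are `half 0` and `half 1`. -/
def half (e : I) : C(I, I) where
  toFun t := ⟨(e + t) / 2, by linarith [e.2.1, t.2.1], by linarith [e.2.2, t.2.2]⟩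
  continuous_toFun := by fun_prop

theorem half_zero_one : half 0 1 = half 1 0 :=
  Subtype.ext (by simp [half])

theorem lipschitzWith_half (e : I) : LipschitzWith 2⁻¹ (half e) :=
  LipschitzWith.of_dist_le_mul fun s t => by
    simp only [Subtype.dist_eq, Real.dist_eq, half, ContinuousMap.coe_mk, ← sub_div,
      add_sub_add_left_eq_sub, abs_div, abs_two, NNReal.coe_inv, NNReal.coe_ofNat]
    exact (div_eq_inv_mul _ _).le

/-- Iterating the contractions `s j` makes the pieces so small that `hloc` applies to them. -/
theorem subdivision_induction {Q J : Type*} [PseudoMetricSpace Q] [CompactSpace Q] [Nonempty Q]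
    {s : J → C(Q, Q)} {K : NNReal} (hK : K < 1) (hs : ∀ j, LipschitzWith K (s j))
    {P : C(Q, X) → Prop} (hP : ∀ f, (∀ j, P (f.comp (s j))) → P f) (f : C(Q, X))
    (hloc : ∀ q, ∃ N ∈ 𝓝 q, ∀ g : C(Q, Q), (∀ r, g r ∈ N) → P (f.comp g)) : P f := by
  choose N hN hPN using hloc
  obtain ⟨V, hV, hVN⟩ := lebesgue_number_lemma_nhds isCompact_univ fun q _ => hN q
  obtain ⟨ε, hε, hεV⟩ := Metric.mem_uniformity_dist.1 hV
  obtain ⟨n, hn⟩ : ∃ n : ℕ, (K : ℝ) ^ n * Metric.diam (univ : Set Q) < ε := by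
    have hlim := (tendsto_pow_atTop_nhds_zero_of_lt_one K.coe_nonneg hK).mul_const
      (Metric.diam (univ : Set Q))
    rw [zero_mul] at hlim
    exact (hlim.eventually_lt_const hε).exists
  have small (g : C(Q, Q)) (hg : LipschitzWith (K ^ n) g) : P (f.comp g) := by
    obtain ⟨q⟩ := ‹Nonempty Q›
    obtain ⟨y, hy⟩ := hVN (g q) (mem_univ _)
    refine hPN y g fun r => hy (hεV ?_)
    calc dist (g q) (g r) ≤ K ^ n * dist q r := by simpa using hg.dist_le_mul q r
      _ ≤ K ^ n * Metric.diam (univ : Set Q) := by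
        gcongr
        exact Metric.dist_le_diam_of_mem Metric.isBounded_of_compactSpace (mem_univ q) (mem_univ r)
      _ < ε := hn
  have refine_piece (k : ℕ) (_ : k < n)
      (ih : ∀ g : C(Q, Q), LipschitzWith (K ^ (k + 1)) g → P (f.comp g))
      (g : C(Q, Q)) (hg : LipschitzWith (K ^ k) g) : P (f.comp g) :=
    hP _ fun j => ih (g.comp (s j)) (pow_succ K k ▸ hg.comp (hs j))
  exact Nat.decreasingInduction (motive := fun k _ =>
    ∀ g : C(Q, Q), LipschitzWith (K ^ k) g → P (f.comp g)) refine_piece small n.zero_le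
    (ContinuousMap.id Q) (pow_zero K ▸ LipschitzWith.id)

theorem path_induction {P : C(I, X) → Prop} (hP : ∀ f, (∀ e, P (f.comp (half e))) → P f)
    (f : C(I, X)) (hloc : ∀ t, ∃ N ∈ 𝓝 t, ∀ g : C(I, I), (∀ r, g r ∈ N) → P (f.comp g)) : P f :=
  subdivision_induction two_inv_lt_one lipschitzWith_half hP f hloc

theorem square_induction {P : C(I × I, X) → Prop}
    (hP : ∀ f, (∀ e e', P (f.comp ((half e).prodMap (half e')))) → P f) (f : C(I × I, X))
    (hloc : ∀ q, ∃ N ∈ 𝓝 q, ∀ g : C(I × I, I × I), (∀ r, g r ∈ N) → P (f.comp g)) : P f :=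
  subdivision_induction (s := fun e : I × I => (half e.1).prodMap (half e.2))
    two_inv_lt_one (fun e => by
      have h := ((lipschitzWith_half e.1).comp .prod_fst).prodMk
        ((lipschitzWith_half e.2).comp .prod_snd)
      rw [mul_one, max_self] at h
      exact h)
    (fun f h => hP f fun e e' => h (e, e')) f hloc

theorem trans_comp_half_zero {x y z : X} (γ : Path x y) (δ : Path y z) :
    (γ.trans δ : C(I, X)).comp (half 0) = γ := by
  ext t
  have ht : (half 0 t : ℝ) ≤ 1 / 2 := by
    simpa [half] using div_le_div_of_nonneg_right t.2.2 zero_le_two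
  simp only [ContinuousMap.comp_apply, ContinuousMap.coe_coe, Path.trans_apply, dif_pos ht]
  congr 1
  exact Subtype.ext (by simp [half, mul_div_cancel₀])

theorem trans_comp_half_one {x y z : X} (γ : Path x y) (δ : Path y z) :
    (γ.trans δ : C(I, X)).comp (half 1) = δ := by
  ext t
  by_cases ht : (half 1 t : ℝ) ≤ 1 / 2
  · obtain rfl : t = 0 := Subtype.ext (by
      simp only [half, ContinuousMap.coe_mk, Icc.coe_one] at ht
      rw [Icc.coe_zero]
      linarith [t.2.1])
    rw [ContinuousMap.comp_apply, ← half_zero_one, ← ContinuousMap.comp_apply,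
      trans_comp_half_zero]
    simp only [ContinuousMap.coe_coe, Path.source, Path.target]
  · simp only [ContinuousMap.comp_apply, ContinuousMap.coe_coe, Path.trans_apply, dif_neg ht]
    congr 1
    exact Subtype.ext (by simp [half, mul_div_cancel₀])

theorem eq_of_comp_half {f g : C(I, X)} (h₀ : f.comp (half 0) = g.comp (half 0))
    (h₁ : f.comp (half 1) = g.comp (half 1)) : f = g := by
  ext t
  have lower (ht : (t : ℝ) ≤ 1 / 2) : t ∈ range (half 0) :=
    ⟨⟨2 * t, by linarith [t.2.1], by linarith⟩, Subtype.ext (by simp [half])⟩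
  have upper (ht : 1 / 2 ≤ (t : ℝ)) : t ∈ range (half 1) :=
    ⟨⟨2 * t - 1, by linarith, by linarith [t.2.2]⟩, Subtype.ext (by simp [half])⟩
  rcases (le_total (t : ℝ) (1 / 2)).imp lower upper with ⟨r, rfl⟩ | ⟨r, rfl⟩
  · exact congr($h₀ r)
  · exact congr($h₁ r)

end Bisection

/-! ### Path cocycles -/

/-- A function on the paths of `X` with values in a group that is invariant under homotopies
relative to the end points and takes products of paths to products; in other words, a functor from
the fundamental groupoid of `X` to the group. Paths are regarded as elements of `C(I, X)`, so that
no end points have to be transported along equalities. -/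
@[ext]
structure PathCocycle (X G : Type*) [TopologicalSpace X] [Group G] where
  toFun : C(I, X) → G
  map_homotopic' {x y : X} {γ δ : Path x y} : γ.Homotopic δ → toFun γ = toFun δ
  map_trans' {x y z : X} (γ : Path x y) (δ : Path y z) : toFun (γ.trans δ) = toFun γ * toFun δ

namespace PathCocycle

variable {X Y G : Type*} [TopologicalSpace X] [TopologicalSpace Y] [Group G]

instance : CoeFun (PathCocycle X G) (fun _ => C(I, X) → G) := ⟨toFun⟩

theorem map_homotopic (c : PathCocycle X G) {x y : X} {γ δ : Path x y} (h : γ.Homotopic δ) :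
    c γ = c δ :=
  c.map_homotopic' h

theorem map_trans (c : PathCocycle X G) {x y z : X} (γ : Path x y) (δ : Path y z) :
    c (γ.trans δ) = c γ * c δ :=
  c.map_trans' γ δ

theorem map_refl (c : PathCocycle X G) (x : X) : c (Path.refl x) = 1 := by
  have h := c.map_trans (Path.refl x) (Path.refl x)
  rw [Path.refl_trans_refl] at h
  exact left_eq_mul.mp h

theorem map_symm (c : PathCocycle X G) {x y : X} (γ : Path x y) : c γ.symm = (c γ)⁻¹ := by
  rw [eq_inv_iff_mul_eq_one, ← c.map_trans, ← c.map_refl y]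
  exact c.map_homotopic ⟨(Path.Homotopy.reflSymmTrans γ).symm⟩

theorem map_half_mul_map_half (c : PathCocycle X G) (f : C(I, X)) :
    c (f.comp (half 0)) * c (f.comp (half 1)) = c f := by
  let γ : Path (f (half 0 0)) (f (half 0 1)) := ⟨f.comp (half 0), rfl, rfl⟩
  let δ : Path (f (half 0 1)) (f (half 1 1)) :=
    ⟨f.comp (half 1), congrArg f half_zero_one.symm, rfl⟩
  have hf : (γ.trans δ : C(I, X)) = f :=
    eq_of_comp_half (trans_comp_half_zero γ δ) (trans_comp_half_one γ δ)
  rw [← hf, c.map_trans, trans_comp_half_zero, trans_comp_half_one]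

/-- The pull-back of a cocycle along a continuous map. -/
def pull (c : PathCocycle X G) (g : C(Y, X)) : PathCocycle Y G where
  toFun f := c (g.comp f)
  map_homotopic' h := c.map_homotopic (h.map g)
  map_trans' γ δ := by
    have := c.map_trans (γ.map g.continuous) (δ.map g.continuous)
    rw [← Path.map_trans] at this
    exact this

theorem pull_apply (c : PathCocycle X G) (g : C(Y, X)) (f : C(I, Y)) :
    c.pull g f = c (g.comp f) := rfl

/-- The cocycle `γ ↦ (s x)⁻¹ * c γ * s y`, for paths `γ` from `x` to `y`, that is cohomologous
to `c` by means of `s`. -/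
def twist (c : PathCocycle X G) (s : X → G) : PathCocycle X G where
  toFun f := (s (f 0))⁻¹ * c f * s (f 1)
  map_homotopic' h := by
    simp only [ContinuousMap.coe_coe, Path.source, Path.target, c.map_homotopic h]
  map_trans' γ δ := by
    simp only [ContinuousMap.coe_coe, Path.source, Path.target, c.map_trans]
    group

theorem twist_apply (c : PathCocycle X G) (s : X → G) {x y : X} (γ : Path x y) :
    c.twist s γ = (s x)⁻¹ * c γ * s y := by
  simp only [twist, ContinuousMap.coe_coe, Path.source, Path.target]

theorem twist_one (c : PathCocycle X G) : c.twist 1 = c :=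
  PathCocycle.ext (funext fun f => by simp [twist])

theorem map_comp_mul [SimplyConnectedSpace Y] (c : PathCocycle X G) (F : C(Y, X)) {x y y' z : Y}
    (α : Path x y) (β : Path y z) (α' : Path x y') (β' : Path y' z) :
    c (F.comp α) * c (F.comp β) = c (F.comp α') * c (F.comp β') := by
  simp only [← pull_apply, ← map_trans]
  exact (c.pull F).map_homotopic (SimplyConnectedSpace.paths_homotopic _ _)

end PathCocycle

/-! ### Gluing local cocycles -/

section Gluing

variable {X G : Type*} [TopologicalSpace X] [Group G]

/-- The inclusion of a subset, as a continuous map. -/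
abbrev incl (W : Set X) : C(W, X) := ⟨Subtype.val, continuous_subtype_val⟩

/-- The function `ℓ` is given by a cocycle on the paths that run in `W`. -/
def IsCocycleOn (ℓ : C(I, X) → G) (W : Set X) : Prop :=
  ∃ k : PathCocycle W G, ∀ f : C(I, W), ℓ ((incl W).comp f) = k f

/-- The path `t ↦ F (t, s)`. -/
def hSide (F : C(I × I, X)) (s : I) : C(I, X) := F.comp ((ContinuousMap.id I).prodMk (.const I s))

/-- The path `t ↦ F (s, t)`. -/
def vSide (F : C(I × I, X)) (s : I) : C(I, X) := F.comp ((ContinuousMap.const I s).prodMk (.id I))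

/-- The two ways from `(0, 0)` to `(1, 1)` along the boundary of a singular square `F` give the
same product of values of `v`. -/
def BoundaryCommutes (v : C(I, X) → G) (F : C(I × I, X)) : Prop :=
  v (hSide F 0) * v (vSide F 1) = v (vSide F 0) * v (hSide F 1)

/-- The product of the values of `ℓ` on the `2 ^ n` pieces of equal length of a path. -/
def dyadicProd (ℓ : C(I, X) → G) : ℕ → C(I, X) → G
  | 0, f => ℓ f
  | n + 1, f => dyadicProd ℓ n (f.comp (half 0)) * dyadicProd ℓ n (f.comp (half 1))

theorem PathCocycle.boundaryCommutes (c : PathCocycle X G) (F : C(I × I, X)) :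
    BoundaryCommutes c F := by
  have := (convex_Icc (0 : ℝ) 1).contractibleSpace ⟨0, left_mem_Icc.2 zero_le_one⟩
  let h (s : I) : Path ((0 : I), s) (1, s) :=
    ⟨(ContinuousMap.id I).prodMk (.const I s), rfl, rfl⟩
  let v (s : I) : Path (s, (0 : I)) (s, 1) :=
    ⟨(ContinuousMap.const I s).prodMk (.id I), rfl, rfl⟩
  exact c.map_comp_mul F (h 0) (v 1) (v 0) (h 1)

theorem dyadicProd_eq_of_isCocycleOn {ℓ : C(I, X) → G} {W : Set X} (hW : IsCocycleOn ℓ W) (n : ℕ)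
    (f : C(I, W)) : dyadicProd ℓ n ((incl W).comp f) = ℓ ((incl W).comp f) := by
  induction n generalizing f with
  | zero => rfl
  | succ n ih =>
    obtain ⟨k, hk⟩ := hW
    rw [dyadicProd, ContinuousMap.comp_assoc, ContinuousMap.comp_assoc, ih, ih, hk, hk, hk,
      k.map_half_mul_map_half]

theorem exists_eq_comp_of_isInducing {Q Y : Type*} [TopologicalSpace Q] [TopologicalSpace Y]
    {j : C(Y, X)}
    (hj : IsInducing j) {f : C(Q, X)} (hf : ∀ q, f q ∈ range j) : ∃ g : C(Q, Y), f = j.comp g := by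
  choose g hg using hf
  exact ⟨⟨g, hj.continuous_iff.2 (by simpa only [comp_def, hg] using f.continuous)⟩,
    ContinuousMap.ext fun q => (hg q).symm⟩

theorem exists_eq_incl_comp {Q : Type*} [TopologicalSpace Q] {W : Set X} {f : C(Q, X)}
    (hf : ∀ q, f q ∈ W) : ∃ g : C(Q, W), f = (incl W).comp g :=
  exists_eq_comp_of_isInducing IsInducing.subtypeVal fun q => ⟨⟨f q, hf q⟩, rfl⟩

theorem exists_eventually_dyadicProd_eq {ℓ : C(I, X) → G}
    (hℓ : ∀ x, ∃ W ∈ 𝓝 x, IsCocycleOn ℓ W) (f : C(I, X)) :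
    ∃ g, ∀ᶠ n in atTop, dyadicProd ℓ n f = g := by
  refine path_induction (P := fun f => ∃ g, ∀ᶠ n in atTop, dyadicProd ℓ n f = g)
    (fun f hf => ?_) f fun t => ?_
  · obtain ⟨g₀, h₀⟩ := hf 0
    obtain ⟨g₁, h₁⟩ := hf 1
    refine ⟨g₀ * g₁, ?_⟩
    rw [← map_add_atTop_eq_nat 1, eventually_map]
    filter_upwards [h₀, h₁] with n hn₀ hn₁
    rw [dyadicProd, hn₀, hn₁]
  · obtain ⟨W, hWt, hW⟩ := hℓ (f t)
    refine ⟨f ⁻¹' W, f.continuous.continuousAt hWt, fun g hg => ?_⟩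
    obtain ⟨g', hg'⟩ := exists_eq_incl_comp (f := f.comp g) hg
    exact ⟨_, .of_forall fun n => hg' ▸ dyadicProd_eq_of_isCocycleOn hW n g'⟩

theorem exists_mul_halves_eq {ℓ : C(I, X) → G} (hℓ : ∀ x, ∃ W ∈ 𝓝 x, IsCocycleOn ℓ W) :
    ∃ v : C(I, X) → G, (∀ f, v (f.comp (half 0)) * v (f.comp (half 1)) = v f) ∧
      ∀ W, IsCocycleOn ℓ W → ∀ f : C(I, W), v ((incl W).comp f) = ℓ ((incl W).comp f) := by
  choose v hv using exists_eventually_dyadicProd_eq hℓ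
  refine ⟨v, fun f => ?_, fun W hW f => ?_⟩
  · have hf := (tendsto_add_atTop_nat 1).eventually (hv f)
    obtain ⟨n, h₀, h₁, h⟩ := ((hv (f.comp (half 0))).and ((hv (f.comp (half 1))).and hf)).exists
    rw [← h, ← h₀, ← h₁, dyadicProd]
  · obtain ⟨n, hn⟩ := (hv ((incl W).comp f)).exists
    rw [← hn, dyadicProd_eq_of_isCocycleOn hW]

theorem boundaryCommutes_of_quarters {v : C(I, X) → G}
    (hv : ∀ f, v (f.comp (half 0)) * v (f.comp (half 1)) = v f) (F : C(I × I, X))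
    (hF : ∀ e e', BoundaryCommutes v (F.comp ((half e).prodMap (half e')))) :
    BoundaryCommutes v F := by
  have half_zero_zero : half 0 0 = 0 := Subtype.ext (by simp [half])
  have half_one_one : half 1 1 = 1 := Subtype.ext (by norm_num [half])
  let h (e s : I) : G := v ((hSide F s).comp (half e))
  let w (e s : I) : G := v ((vSide F s).comp (half e))
  have quarter (e e' : I) :
      h e (half e' 0) * w e' (half e 1) = w e' (half e 0) * h e (half e' 1) := hF e e'
  have h₀₀ := quarter 0 0
  have h₁₀ := quarter 1 0
  have h₀₁ := quarter 0 1
  have h₁₁ := quarter 1 1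
  simp only [half_zero_zero, half_one_one, half_zero_one] at h₀₀ h₁₀ h₀₁ h₁₁
  rw [BoundaryCommutes, ← hv (hSide F 0), ← hv (vSide F 1), ← hv (vSide F 0), ← hv (hSide F 1)]
  calc h 0 0 * h 1 0 * (w 0 1 * w 1 1)
    _ = h 0 0 * (h 1 0 * w 0 1) * w 1 1 := by simp only [mul_assoc]
    _ = h 0 0 * w 0 (half 1 0) * (h 1 (half 1 0) * w 1 1) := by rw [h₁₀]; simp only [mul_assoc]
    _ = w 0 0 * (h 0 (half 1 0) * w 1 (half 1 0)) * h 1 1 := by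
      rw [h₀₀, h₁₁]; simp only [mul_assoc]
    _ = w 0 0 * w 1 0 * (h 0 1 * h 1 1) := by rw [h₀₁]; simp only [mul_assoc]

theorem boundaryCommutes_of_local {ℓ v : C(I, X) → G}
    (hℓ : ∀ x, ∃ W ∈ 𝓝 x, IsCocycleOn ℓ W)
    (hv : ∀ f, v (f.comp (half 0)) * v (f.comp (half 1)) = v f)
    (hvℓ : ∀ W, IsCocycleOn ℓ W → ∀ f : C(I, W), v ((incl W).comp f) = ℓ ((incl W).comp f))
    (F : C(I × I, X)) : BoundaryCommutes v F := by
  refine square_induction (boundaryCommutes_of_quarters hv) F fun q => ?_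
  obtain ⟨W, hWq, hW⟩ := hℓ (F q)
  refine ⟨F ⁻¹' W, F.continuous.continuousAt hWq, fun g hg => ?_⟩
  obtain ⟨F', hF'⟩ := exists_eq_incl_comp (f := F.comp g) hg
  obtain ⟨k, hk⟩ := id hW
  have hvk (f : C(I, W)) : v ((incl W).comp f) = k f := (hvℓ W hW f).trans (hk f)
  have := k.boundaryCommutes F'
  rw [BoundaryCommutes, ← hvk, ← hvk, ← hvk, ← hvk] at this
  rw [hF']
  exact this

theorem exists_cocycle_of_local {ℓ : C(I, X) → G} (hℓ : ∀ x, ∃ W ∈ 𝓝 x, IsCocycleOn ℓ W) :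
    ∃ c : PathCocycle X G,
      ∀ W, IsCocycleOn ℓ W → ∀ f : C(I, W), c ((incl W).comp f) = ℓ ((incl W).comp f) := by
  obtain ⟨v, hv, hvℓ⟩ := exists_mul_halves_eq hℓ
  have v_const (x : X) : v (.const I x) = 1 := left_eq_mul.mp (hv (.const I x)).symm
  refine ⟨⟨v, ?_, fun γ δ => ?_⟩, hvℓ⟩
  · rintro x y γ δ ⟨H⟩
    have hH := boundaryCommutes_of_local hℓ hv hvℓ H.toContinuousMap
    have h₀ : hSide H.toContinuousMap 0 = .const I x := ContinuousMap.ext H.source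
    have h₁ : hSide H.toContinuousMap 1 = .const I y := ContinuousMap.ext H.target
    have v₀ : vSide H.toContinuousMap 0 = γ := ContinuousMap.ext H.apply_zero
    have v₁ : vSide H.toContinuousMap 1 = δ := ContinuousMap.ext H.apply_one
    rw [BoundaryCommutes, h₀, h₁, v₀, v₁, v_const, v_const, one_mul, mul_one] at hH
    exact hH.symm
  · rw [← hv, trans_comp_half_zero, trans_comp_half_one]

theorem incl_comp_injective {Q : Type*} [TopologicalSpace Q] (W : Set X) :
    Injective fun f : C(Q, W) => (incl W).comp f := fun _ _ h =>
  ContinuousMap.ext fun q => Subtype.ext congr($h q)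

theorem exists_pull_eq_of_open_cover {U V : Set X} (hU : IsOpen U) (hV : IsOpen V)
    (hUV : U ∪ V = univ) (c : PathCocycle U G) (d : PathCocycle V G)
    (hcd : c.pull (.inclusion inter_subset_left) =
      d.pull (.inclusion (inter_subset_right : U ∩ V ⊆ V))) :
    ∃ k : PathCocycle X G, k.pull (incl U) = c ∧ k.pull (incl V) = d := by
  let ℓ : C(I, X) → G :=
    extend (fun f => (incl U).comp f) c (extend (fun f => (incl V).comp f) d 1)
  have hℓU (f : C(I, U)) : ℓ ((incl U).comp f) = c f := (incl_comp_injective U).extend_apply _ _ f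
  have hℓV (f : C(I, V)) : ℓ ((incl V).comp f) = d f := by
    by_cases h : ∃ g : C(I, U), (incl U).comp g = (incl V).comp f
    · obtain ⟨g, hg⟩ := h
      obtain ⟨r, hr⟩ := exists_eq_incl_comp (W := U ∩ V) (f := (incl V).comp f)
        fun t => ⟨congr($hg t) ▸ (g t).2, (f t).2⟩
      have hgr : g = (ContinuousMap.inclusion inter_subset_left).comp r :=
        incl_comp_injective U (hg.trans hr)
      have hfr : f = (ContinuousMap.inclusion inter_subset_right).comp r :=
        incl_comp_injective V hr
      rw [← hg, hℓU, hgr, hfr]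
      exact congr(($hcd).toFun r)
    · exact (extend_apply' _ _ _ h).trans ((incl_comp_injective V).extend_apply _ _ f)
  have hℓ (x : X) : ∃ W ∈ 𝓝 x, IsCocycleOn ℓ W := by
    rcases hUV.symm ▸ mem_univ x with hx | hx
    · exact ⟨U, hU.mem_nhds hx, c, hℓU⟩
    · exact ⟨V, hV.mem_nhds hx, d, hℓV⟩
  obtain ⟨k, hk⟩ := exists_cocycle_of_local hℓ
  exact ⟨k, PathCocycle.ext (funext fun f => (hk U ⟨c, hℓU⟩ f).trans (hℓU f)),
    PathCocycle.ext (funext fun f => (hk V ⟨d, hℓV⟩ f).trans (hℓV f))⟩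

end Gluing

/-! ### Cocycles and fundamental groups -/

section FundamentalGroup

variable {X Y G : Type*} [TopologicalSpace X] [TopologicalSpace Y] [Group G]

theorem loopClass_surjective (b : X) : Surjective (loopClass (x := b)) := fun g =>
  (Path.Homotopic.Quotient.mk_surjective (FundamentalGroup.toPath g.unop)).imp fun _ hγ =>
    congrArg MulOpposite.op hγ

theorem loopClass_eq_iff {b : X} {γ δ : Path b b} : loopClass γ = loopClass δ ↔ γ.Homotopic δ :=
  MulOpposite.op_injective.eq_iff.trans Path.Homotopic.Quotient.eq

theorem symm_trans_cancel_left {x y z : X} (p : Path.Homotopic.Quotient x y)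
    (q : Path.Homotopic.Quotient y z) : p.symm.trans (p.trans q) = q := by
  rw [← Path.Homotopic.Quotient.trans_assoc, Path.Homotopic.Quotient.symm_trans,
    Path.Homotopic.Quotient.refl_trans]

theorem changeBase_eq_conj {a b : X} (p q : Path b a) (α : PiOne X a) :
    changeBase p α =
      loopClass (p.trans q.symm) * changeBase q α * (loopClass (p.trans q.symm))⁻¹ := by
  obtain ⟨r, rfl⟩ := loopClass_surjective a α
  refine loopClass_eq_iff.2 (Path.Homotopic.Quotient.eq.1 ?_)
  simp only [Path.trans_symm, Path.symm_symm, Path.Homotopic.Quotient.mk_trans,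
    Path.Homotopic.Quotient.mk_symm, Path.Homotopic.Quotient.trans_assoc, symm_trans_cancel_left]

theorem piOneMap_changeBase (f : C(X, Y)) {a b : X} (p : Path b a) (α : PiOne X a) :
    piOneMap f b (changeBase p α) = changeBase (p.map f.continuous) (piOneMap f a α) := by
  obtain ⟨r, rfl⟩ := loopClass_surjective a α
  rw [changeBase_loopClass, piOneMap_loopClass, piOneMap_loopClass, changeBase_loopClass,
    Path.map_trans, Path.map_trans, Path.map_symm]

namespace PathCocycle

/-- The homomorphism on the fundamental group defined by a cocycle. -/
def hom (c : PathCocycle X G) (b : X) : PiOne X b →* G where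
  toFun g := Quotient.lift (fun γ : Path b b => c γ) (fun _ _ => c.map_homotopic) g.unop
  map_one' := c.map_refl b
  map_mul' g h := by
    obtain ⟨γ, rfl⟩ := loopClass_surjective b g
    obtain ⟨δ, rfl⟩ := loopClass_surjective b h
    exact c.map_trans γ δ

theorem hom_loopClass (c : PathCocycle X G) {b : X} (γ : Path b b) :
    c.hom b (loopClass γ) = c γ := rfl

theorem hom_piOneMap (c : PathCocycle X G) (f : C(Y, X)) (y : Y) (α : PiOne Y y) :
    c.hom (f y) (piOneMap f y α) = (c.pull f).hom y α := by
  obtain ⟨r, rfl⟩ := loopClass_surjective y α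
  rfl

theorem hom_changeBase (c : PathCocycle X G) {a b : X} (p : Path b a) (α : PiOne X a) :
    c.hom b (changeBase p α) = c p * c.hom a α * (c p)⁻¹ := by
  obtain ⟨r, rfl⟩ := loopClass_surjective a α
  rw [changeBase_loopClass, hom_loopClass, hom_loopClass, map_trans, map_trans, map_symm, mul_assoc]

theorem exists_hom_eq [PathConnectedSpace X] (b : X) (φ : PiOne X b →* G) :
    ∃ c : PathCocycle X G, c.hom b = φ := by
  classical
  let w : ∀ x, Path b x := update (fun x => PathConnectedSpace.somePath b x) b (Path.refl b)
  let v (f : C(I, X)) : G :=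
    φ (loopClass ((w (f 0)).trans ((⟨f, rfl, rfl⟩ : Path (f 0) (f 1)).trans (w (f 1)).symm)))
  have hv {x y : X} (γ : Path x y) : v γ = φ (loopClass ((w x).trans (γ.trans (w y).symm))) := by
    obtain ⟨f, rfl, rfl⟩ := γ
    rfl
  refine ⟨⟨v, fun {x y γ δ} h => ?_, fun {x y z} γ δ => ?_⟩, ?_⟩
  · rw [hv, hv]
    exact congrArg φ (loopClass_eq_iff.2 ((Path.Homotopic.refl _).hcomp (h.hcomp (.refl _))))
  · rw [hv, hv, hv, ← map_mul, ← loopClass_trans]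
    refine congrArg φ (loopClass_eq_iff.2 (Path.Homotopic.Quotient.eq.1 ?_))
    simp only [Path.Homotopic.Quotient.mk_trans, Path.Homotopic.Quotient.mk_symm,
      Path.Homotopic.Quotient.trans_assoc, symm_trans_cancel_left]
  · ext g
    obtain ⟨γ, rfl⟩ := loopClass_surjective b g
    refine (hv γ).trans (congrArg φ (loopClass_eq_iff.2 (Path.Homotopic.Quotient.eq.1 ?_)))
    have hw : w b = Path.refl b := update_self _ _ _
    rw [hw]
    simp

theorem ext_of_path {c d : PathCocycle X G} (h : ∀ {x y : X} (γ : Path x y), c γ = d γ) : c = d :=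
  PathCocycle.ext (funext fun f => h ⟨f, rfl, rfl⟩)

theorem hom_twist (c : PathCocycle X G) {s : X → G} {b : X} (hs : s b = 1) :
    (c.twist s).hom b = c.hom b := by
  ext g
  obtain ⟨γ, rfl⟩ := loopClass_surjective b g
  rw [hom_loopClass, hom_loopClass, twist_apply, hs, inv_one, one_mul, mul_one]

/-- The function `s` is propagated from the points `a i` along arbitrary paths; the hypothesis `h`
makes the result independent of their choice. -/
theorem exists_twist_eq {ι : Type*} {a : ι → X} (ha : ∀ x, ∃! i, Joined (a i) x)
    (c d : PathCocycle X G) (g : ι → G)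
    (h : ∀ i (r : Path (a i) (a i)), c r * g i = g i * d r) :
    ∃ s : X → G, (∀ i, s (a i) = g i) ∧ c.twist s = d := by
  choose i hi huniq using ha
  let s (x : X) : G := (c (hi x).somePath)⁻¹ * g (i x) * d (hi x).somePath
  have hs {j : ι} {x : X} (w : Path (a j) x) : s x = (c w)⁻¹ * g j * d w := by
    obtain rfl := huniq x j ⟨w⟩
    have hloop := h (i x) ((hi x).somePath.trans w.symm)
    rw [map_trans, map_trans, map_symm, map_symm] at hloop
    calc s x = (c (hi x).somePath)⁻¹ * (g (i x) * (d (hi x).somePath * (d w)⁻¹)) * d w := by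
          simp only [s]; group
      _ = (c w)⁻¹ * g (i x) * d w := by rw [← hloop]; group
  refine ⟨s, fun j => by simp [hs (Path.refl (a j)), map_refl], ext_of_path fun {x y} γ => ?_⟩
  rw [twist_apply, hs (hi x).somePath, hs ((hi x).somePath.trans γ), map_trans, map_trans]
  group

theorem exists_twist_eq_of_hom_eq [PathConnectedSpace X] {c d : PathCocycle X G} {b : X}
    (h : c.hom b = d.hom b) : ∃ s : X → G, s b = 1 ∧ c.twist s = d := by
  obtain ⟨s, hs, hcd⟩ := exists_twist_eq (a := fun _ : Unit => b)
    (fun x => ⟨(), PathConnectedSpace.joined b x, fun _ _ => rfl⟩) c d 1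
    fun _ r => by simpa [hom_loopClass] using congr($h (loopClass r))
  exact ⟨s, hs (), hcd⟩

theorem eq_of_twist_eq {c d : PathCocycle X G} {s s' : X → G} (h : c.twist s = d)
    (h' : c.twist s' = d) {x y : X} (hxy : Joined x y) (hx : s x = s' x) : s y = s' y := by
  obtain ⟨γ⟩ := hxy
  have := congr(($(h.trans h'.symm)).toFun γ)
  rw [twist_apply, twist_apply, hx] at this
  exact mul_left_cancel this

theorem eq_of_pull_eq {Y₁ Y₂ : Type*} [TopologicalSpace Y₁] [TopologicalSpace Y₂] {j₁ : C(Y₁, X)}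
    {j₂ : C(Y₂, X)} (hj₁ : IsInducing j₁) (hj₂ : IsInducing j₂) (hj : range j₁ ∪ range j₂ = univ)
    (ho₁ : ∀ f : C(I, X), IsOpen (f ⁻¹' range j₁)) (ho₂ : ∀ f : C(I, X), IsOpen (f ⁻¹' range j₂))
    {c d : PathCocycle X G} (h₁ : c.pull j₁ = d.pull j₁) (h₂ : c.pull j₂ = d.pull j₂) : c = d := by
  refine PathCocycle.ext (funext fun f => path_induction (P := fun f => c f = d f)
    (fun f hf => ?_) f fun t => ?_)
  · rw [← c.map_half_mul_map_half, hf, hf, d.map_half_mul_map_half]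
  · rcases hj.symm ▸ mem_univ (f t) with ht | ht
    · refine ⟨_, (ho₁ f).mem_nhds ht, fun g hg => ?_⟩
      obtain ⟨r, hr⟩ := exists_eq_comp_of_isInducing hj₁ (f := f.comp g) hg
      exact hr ▸ congr(($h₁).toFun r)
    · refine ⟨_, (ho₂ f).mem_nhds ht, fun g hg => ?_⟩
      obtain ⟨r, hr⟩ := exists_eq_comp_of_isInducing hj₂ (f := f.comp g) hg
      exact hr ▸ congr(($h₂).toFun r)

end PathCocycle

end FundamentalGroup

/-! ### The glued space -/

section Glue

variable {X : Type*} [TopologicalSpace X] {U V B : Set X}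

theorem range_glueInl_union_range_glueInr :
    range (glueInl U V B) ∪ range (glueInr U V B) = univ :=
  eq_univ_of_forall <| by
    rintro ⟨u | v⟩
    · exact Or.inl ⟨u, rfl⟩
    · exact Or.inr ⟨v, rfl⟩

theorem isInducing_glueInl : IsInducing (glueInl U V B) :=
  .of_comp (glueInl U V B).continuous (glueToX U V B).continuous IsInducing.subtypeVal

theorem isInducing_glueInr : IsInducing (glueInr U V B) :=
  .of_comp (glueInr U V B).continuous (glueToX U V B).continuous IsInducing.subtypeVal

theorem pathConnectedSpace_glue (hU : IsPathConnected U) (hV : IsPathConnected V)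
    {b : X} (hbU : b ∈ U) (hbV : b ∈ V) (hbB : b ∈ B) : PathConnectedSpace (Glue U V B) := by
  have := isPathConnected_iff_pathConnectedSpace.1 hU
  have := isPathConnected_iff_pathConnectedSpace.1 hV
  rw [pathConnectedSpace_iff_univ, ← range_glueInl_union_range_glueInr]
  exact (isPathConnected_range (glueInl U V B).continuous).union
    (isPathConnected_range (glueInr U V B).continuous)
    ⟨_, ⟨⟨b, hbU⟩, rfl⟩, ⟨b, hbV⟩, glueInl_eq_glueInr hbU hbV hbB⟩

theorem exists_fun_glue {Z : Type*} (e₁ : U → Z) (e₂ : V → Z)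
    (h : ∀ x (hU : x ∈ U) (hV : x ∈ V), x ∈ B → e₁ ⟨x, hU⟩ = e₂ ⟨x, hV⟩) :
    ∃ e : Glue U V B → Z, e ∘ glueInl U V B = e₁ ∧ e ∘ glueInr U V B = e₂ := by
  refine ⟨Quotient.lift (Sum.elim e₁ e₂) ?_, rfl, rfl⟩
  rintro (⟨x, hx⟩ | ⟨x, hx⟩) (⟨y, hy⟩ | ⟨y, hy⟩) (hxy | ⟨rfl : x = y, hB⟩)
  all_goals first | exact congrArg _ hxy | exact h x hx hy hB | exact (h x hy hx hB).symm | rfl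

theorem exists_eq_comp_glueToX {Z : Type*} [Nonempty Z] (e : Glue U V B → Z)
    (h : ∀ x (hU : x ∈ U) (hV : x ∈ V), e (glueInl U V B ⟨x, hU⟩) = e (glueInr U V B ⟨x, hV⟩)) :
    ∃ ε : X → Z, e = ε ∘ glueToX U V B := by
  refine (factorsThrough_iff e).1 ?_
  rintro ⟨⟨x, hx⟩ | ⟨x, hx⟩⟩ ⟨⟨y, hy⟩ | ⟨y, hy⟩⟩ (rfl : x = y)
  exacts [rfl, h x hx hy, (h x hy hx).symm, rfl]

/-- The condition on the part `B` along which `U` and `V` are glued that makes paths in the glued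
space split into paths in `U` and paths in `V`: along each path, `B` is the trace of an open set
containing all of `B`. It is common to the two cases of the theorem, `B` open and `X` Hausdorff. -/
def IsOpenAlongPaths (B : Set X) : Prop :=
  ∀ F : C(I, X), ∃ O : Set X, IsOpen O ∧ B ⊆ O ∧ F ⁻¹' O ⊆ F ⁻¹' B

theorem isOpenAlongPaths_of_isOpen (hB : IsOpen B) : IsOpenAlongPaths B :=
  fun _ => ⟨B, hB, Subset.rfl, Subset.rfl⟩

theorem isOpen_preimage_pathComponentIn {Y : Type*} [TopologicalSpace Y]
    [LocallyPathConnectedSpace Y] {W : Set X} (hW : IsOpen W) (a : X) (f : C(Y, X)) :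
    IsOpen (f ⁻¹' pathComponentIn W a) := by
  refine isOpen_iff_mem_nhds.2 fun y hy => ?_
  have hyW : y ∈ f ⁻¹' W := (pathComponentIn_subset : pathComponentIn W a ⊆ W) hy
  filter_upwards [((hW.preimage f.continuous).pathComponentIn y).mem_nhds
    (mem_pathComponentIn_self hyW)] with z hz
  have hyz : JoinedIn W (f y) (f z) :=
    ((show JoinedIn (f ⁻¹' W) y z from hz).map_continuousOn f.continuous.continuousOn).mono
      (image_preimage_subset _ _)
  exact JoinedIn.trans hy hyz

theorem isOpenAlongPaths_pathComponentIn [T2Space X] {W : Set X} (hW : IsOpen W) (a : X) :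
    IsOpenAlongPaths (pathComponentIn W a) := fun F => by
  have : LocallyPathConnectedSpace I := (convex_Icc (0 : ℝ) 1).locallyPathConnectedSpace
  have hK : IsCompact (F ⁻¹' pathComponentIn W a)ᶜ :=
    (isOpen_preimage_pathComponentIn hW a F).isClosed_compl.isCompact
  refine ⟨(F '' (F ⁻¹' pathComponentIn W a)ᶜ)ᶜ, (hK.image F.continuous).isClosed.isOpen_compl,
    ?_, fun t ht => not_not.1 fun h => ht ⟨t, h, rfl⟩⟩
  rintro _ hx ⟨t, ht, rfl⟩
  exact ht hx

theorem mem_range_glueInl {z : Glue U V B} (hU : glueToX U V B z ∈ U) (hB : glueToX U V B z ∈ B) :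
    z ∈ range (glueInl U V B) := by
  obtain ⟨u | v⟩ := z
  exacts [⟨u, rfl⟩, ⟨⟨v, hU⟩, (glueInl_eq_glueInr hU v.2 hB).symm⟩]

theorem mem_range_glueInr {z : Glue U V B} (hV : glueToX U V B z ∈ V) (hB : glueToX U V B z ∈ B) :
    z ∈ range (glueInr U V B) := by
  obtain ⟨u | v⟩ := z
  exacts [⟨⟨u, hV⟩, glueInl_eq_glueInr u.2 hV hB⟩, ⟨v, rfl⟩]

theorem glueInr_mem_range_glueInl_iff {v : V} :
    glueInr U V B v ∈ range (glueInl U V B) ↔ (v : X) ∈ U ∩ B := by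
  constructor
  · rintro ⟨u, hu⟩
    rcases Quotient.exact hu with h | ⟨h : (u : X) = v, hB⟩
    · cases h
    · exact h ▸ ⟨u.2, hB⟩
  · exact fun h => mem_range_glueInl h.1 h.2

theorem glueInl_mem_range_glueInr_iff {u : U} :
    glueInl U V B u ∈ range (glueInr U V B) ↔ (u : X) ∈ V ∩ B := by
  constructor
  · rintro ⟨v, hv⟩
    rcases Quotient.exact hv with h | ⟨h : (v : X) = u, hB⟩
    · cases h
    · exact h ▸ ⟨v.2, hB⟩
  · exact fun h => mem_range_glueInr h.1 h.2

theorem isOpen_glue_iff {s : Set (Glue U V B)} :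
    IsOpen s ↔ IsOpen (glueInl U V B ⁻¹' s) ∧ IsOpen (glueInr U V B ⁻¹' s) :=
  isOpen_coinduced.trans isOpen_sum_iff

theorem IsOpenAlongPaths.isOpen_preimage_range_glueInl (hB : IsOpenAlongPaths B) (hBU : B ⊆ U)
    (f : C(I, Glue U V B)) : IsOpen (f ⁻¹' range (glueInl U V B)) := by
  obtain ⟨O, hO, hBO, hfO⟩ := hB ((glueToX U V B).comp f)
  have hopen : IsOpen (range (glueInl U V B) ∪ glueToX U V B ⁻¹' O) := by
    refine isOpen_glue_iff.2 ⟨?_, ?_⟩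
    · convert isOpen_univ
      exact eq_univ_of_forall fun u => Or.inl ⟨u, rfl⟩
    · convert hO.preimage (continuous_subtype_val (p := (· ∈ V))) using 1
      exact union_eq_right.2 fun v hv => hBO (glueInr_mem_range_glueInl_iff.1 hv).2
  convert hopen.preimage f.continuous using 1
  refine (union_eq_left.2 fun t ht => ?_).symm
  have htB : glueToX U V B (f t) ∈ B := hfO ht
  exact mem_range_glueInl (hBU htB) htB

theorem IsOpenAlongPaths.isOpen_preimage_range_glueInr (hB : IsOpenAlongPaths B) (hBV : B ⊆ V)
    (f : C(I, Glue U V B)) : IsOpen (f ⁻¹' range (glueInr U V B)) := by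
  obtain ⟨O, hO, hBO, hfO⟩ := hB ((glueToX U V B).comp f)
  have hopen : IsOpen (range (glueInr U V B) ∪ glueToX U V B ⁻¹' O) := by
    refine isOpen_glue_iff.2 ⟨?_, ?_⟩
    · convert hO.preimage (continuous_subtype_val (p := (· ∈ U))) using 1
      exact union_eq_right.2 fun u hu => hBO (glueInl_mem_range_glueInr_iff.1 hu).2
    · convert isOpen_univ
      exact eq_univ_of_forall fun v => Or.inl ⟨v, rfl⟩
  convert hopen.preimage f.continuous using 1
  refine (union_eq_left.2 fun t ht => ?_).symm
  have htB : glueToX U V B (f t) ∈ B := hfO ht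
  exact mem_range_glueInr (hBV htB) htB

theorem IsOpenAlongPaths.cocycle_glue_ext {G : Type*} [Group G] (hB : IsOpenAlongPaths B)
    (hBU : B ⊆ U) (hBV : B ⊆ V) {c d : PathCocycle (Glue U V B) G}
    (hl : c.pull (glueInl U V B) = d.pull (glueInl U V B))
    (hr : c.pull (glueInr U V B) = d.pull (glueInr U V B)) : c = d :=
  PathCocycle.eq_of_pull_eq isInducing_glueInl isInducing_glueInr range_glueInl_union_range_glueInr
    (hB.isOpen_preimage_range_glueInl hBU) (hB.isOpen_preimage_range_glueInr hBV) hl hr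

theorem pull_glueInl_comp_inclusion {G : Type*} [Group G] (c : PathCocycle (Glue U V B) G)
    (hBU : B ⊆ U) (hBV : B ⊆ V) :
    c.pull ((glueInl U V B).comp (.inclusion hBU)) =
      c.pull ((glueInr U V B).comp (.inclusion hBV)) :=
  congrArg c.pull <| ContinuousMap.ext fun x =>
    (glueInl_eq_glueInr (hBU x.2) (hBV x.2) x.2).symm

theorem twist_eq_one_of_isPathConnected {G : Type*} [Group G] {c : PathCocycle (Glue U V B) G}
    {δ : ↥(U ∩ V) → G}
    (hδ : ((c.pull (glueInl U V B)).pull (.inclusion inter_subset_left)).twist δ =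
      (c.pull (glueInr U V B)).pull (.inclusion inter_subset_right))
    (hB : IsPathConnected B) (hBUV : B ⊆ U ∩ V) {b x : ↥(U ∩ V)} (hb : (b : X) ∈ B)
    (hx : (x : X) ∈ B) (hδb : δ b = 1) : δ x = 1 := by
  have := isPathConnected_iff_pathConnectedSpace.1 hB
  let j : C(B, ↥(U ∩ V)) := .inclusion hBUV
  have hδj : (c.pull ((glueInl U V B).comp (.inclusion (hBUV.trans inter_subset_left)))).twist
      (δ ∘ j) = c.pull ((glueInr U V B).comp (.inclusion (hBUV.trans inter_subset_right))) :=
    congrArg (PathCocycle.pull · j) hδ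
  exact PathCocycle.eq_of_twist_eq (x := ⟨b, hb⟩) (y := ⟨x, hx⟩) (s' := 1) hδj
    ((PathCocycle.twist_one _).trans (pull_glueInl_comp_inclusion c _ _))
    (PathConnectedSpace.joined _ _) hδb

theorem IsOpenAlongPaths.exists_pull_glueToX_eq {G : Type*} [Group G] (hB : IsOpenAlongPaths B)
    (hBU : B ⊆ U) (hBV : B ⊆ V) (hU : IsOpen U) (hV : IsOpen V) (hUV : U ∪ V = univ)
    (c : PathCocycle (Glue U V B) G)
    (hc : (c.pull (glueInl U V B)).pull (.inclusion inter_subset_left) =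
      (c.pull (glueInr U V B)).pull (.inclusion (inter_subset_right : U ∩ V ⊆ V))) :
    ∃ d : PathCocycle X G, d.pull (glueToX U V B) = c := by
  obtain ⟨d, hdU, hdV⟩ := exists_pull_eq_of_open_cover hU hV hUV _ _ hc
  exact ⟨d, hB.cocycle_glue_ext hBU hBV hdU hdV⟩

end Glue

/-! ### The universal property of the quotient -/

section HNN

variable {ι G P : Type*} [Group G] [Group P] {H : ι → Type*} [∀ k, Group (H k)]
  {φ ψ : ∀ k, H k →* G}

theorem HNNQuotient.proj_relation (k : ι) (α : H k) :
    proj (φ := φ) (ψ := ψ) (Monoid.Coprod.inl (φ k α)) =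
      proj (Monoid.Coprod.inr (FreeGroup.of k)) * proj (Monoid.Coprod.inl (ψ k α)) *
        (proj (Monoid.Coprod.inr (FreeGroup.of k)))⁻¹ := by
  rw [← mul_inv_eq_one, ← map_inv, ← map_mul, ← map_mul, ← map_inv, ← map_mul]
  exact (QuotientGroup.eq_one_iff _).2 (Subgroup.subset_normalClosure ⟨k, α, rfl⟩)

theorem normalClosure_hnnRelators_le_ker {f : G →* P} {t : ι → P}
    (h : ∀ k α, f (φ k α) = t k * f (ψ k α) * (t k)⁻¹) :
    Subgroup.normalClosure (hnnRelators φ ψ) ≤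
      (Monoid.Coprod.lift f (FreeGroup.lift t)).ker := by
  refine Subgroup.normalClosure_le_normal ?_
  rintro _ ⟨k, α, rfl⟩
  simp [MonoidHom.mem_ker, h]

theorem HNNQuotient.exists_mulEquiv {f : G →* P} {t : ι → P}
    (h : ∀ k α, f (φ k α) = t k * f (ψ k α) * (t k)⁻¹)
    (hext : ∀ χ : P →* P, (∀ g, χ (f g) = f g) → (∀ k, χ (t k) = t k) → χ = .id P)
    {Ψ : P →* HNNQuotient φ ψ} (hΨf : ∀ g, Ψ (f g) = proj (Monoid.Coprod.inl g))
    (hΨt : ∀ k, Ψ (t k) = proj (Monoid.Coprod.inr (FreeGroup.of k))) :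
    ∃ Φ : HNNQuotient φ ψ ≃* P, (∀ g, Φ (proj (Monoid.Coprod.inl g)) = f g) ∧
      ∀ k, Φ (proj (Monoid.Coprod.inr (FreeGroup.of k))) = t k := by
  let Φ : HNNQuotient φ ψ →* P := QuotientGroup.lift _ _ (normalClosure_hnnRelators_le_ker h)
  have hΦf (g : G) : Φ (proj (Monoid.Coprod.inl g)) = f g :=
    Monoid.Coprod.lift_apply_inl f (FreeGroup.lift t) g
  have hΦt (k : ι) : Φ (proj (Monoid.Coprod.inr (FreeGroup.of k))) = t k :=
    (Monoid.Coprod.lift_apply_inr f (FreeGroup.lift t) _).trans FreeGroup.lift_apply_of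
  refine ⟨MonoidHom.toMulEquiv Φ Ψ ?_ ?_, hΦf, hΦt⟩
  · refine QuotientGroup.monoidHom_ext _ (Monoid.Coprod.hom_ext ?_ ?_)
    · exact MonoidHom.ext fun g => (congrArg Ψ (hΦf g)).trans (hΨf g)
    · exact FreeGroup.ext_hom _ _ fun k => (congrArg Ψ (hΦt k)).trans (hΨt k)
  · exact hext _ (fun g => (congrArg Φ (hΨf g)).trans (hΦf g))
      fun k => (congrArg Φ (hΨt k)).trans (hΦt k)

end HNN

/-! ### Homomorphisms out of `π₁(X, b)` -/

section Components

variable {X : Type*} [TopologicalSpace X]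

theorem joined_iff_mem_pathComponentIn {W : Set X} {x y : W} :
    Joined x y ↔ (y : X) ∈ pathComponentIn W (x : X) :=
  (joinedIn_iff_joined x.2 y.2).symm

theorem existsUnique_joined {ι : Type*} {W : Set X} {a : ι → W}
    (hinj : Injective fun i => pathComponentIn W (a i : X))
    (hcover : ⋃ i, pathComponentIn W (a i : X) = W) (x : W) : ∃! i, Joined (a i) x := by
  simp only [joined_iff_mem_pathComponentIn]
  obtain ⟨i, hi⟩ := mem_iUnion.1 (hcover.symm ▸ x.2 : (x : X) ∈ ⋃ i, pathComponentIn W (a i : X))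
  exact ⟨i, hi, fun j hj => hinj ((pathComponentIn_congr hj).symm.trans (pathComponentIn_congr hi))⟩

theorem exists_eq_map_inclusion {W : Set X} {a : W} (r : Path a a) :
    ∃ r' : Path (⟨a, mem_pathComponentIn_self a.2⟩ : pathComponentIn W (a : X))
        ⟨a, mem_pathComponentIn_self a.2⟩,
      r = r'.map (ContinuousMap.inclusion pathComponentIn_subset).continuous := by
  have hr (t : I) : (r t : X) ∈ pathComponentIn W (a : X) :=
    joined_iff_mem_pathComponentIn.1 ⟨(r.truncateOfLE t.2.1).cast (by simp) (by simp)⟩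
  exact ⟨⟨⟨fun t => ⟨r t, hr t⟩, by fun_prop⟩, by simp, by simp⟩, rfl⟩

theorem pathConnectedSpace_of_union {U V : Set X} (hU : IsPathConnected U) (hV : IsPathConnected V)
    (hUV : U ∪ V = univ) {b : X} (hb : b ∈ U ∩ V) : PathConnectedSpace X :=
  pathConnectedSpace_iff_univ.2 (hUV ▸ hU.union hV ⟨b, hb⟩)

end Components

section VanKampen

variable {X : Type*} [TopologicalSpace X] {U V : Set X}

theorem sigmaStar_thetaHat {A B : Set X} {b a : X} (hU : b ∈ U) (hV : b ∈ V) (hB : b ∈ B)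
    (hAU : A ⊆ U) (hAV : A ⊆ V) (ha : a ∈ A) (p : Path (⟨b, hU⟩ : U) ⟨a, hAU ha⟩)
    (q : Path (⟨b, hV⟩ : V) ⟨a, hAV ha⟩) (α : PiOne A ⟨a, ha⟩) :
    sigmaStar U V B hV (thetaHat U V B hU hV hB hAU ha p α) =
      loopClass ((p.map continuous_subtype_val).trans (q.map continuous_subtype_val).symm) *
        sigmaStar U V B hV (theta U V B hV hAV ha q α) *
        (loopClass ((p.map continuous_subtype_val).trans
          (q.map continuous_subtype_val).symm))⁻¹ := by
  have hσp : sigmaStar U V B hV (thetaHat U V B hU hV hB hAU ha p α) =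
      changeBase (p.map continuous_subtype_val) (piOneMap (incl A) ⟨a, ha⟩ α) := by
    obtain ⟨r, rfl⟩ := loopClass_surjective _ α
    exact piOneMap_changeBase (glueToX U V B)
      ((p.map (glueInl U V B).continuous).cast (glueInl_eq_glueInr hU hV hB) rfl) _
  have hσq : sigmaStar U V B hV (theta U V B hV hAV ha q α) =
      changeBase (q.map continuous_subtype_val) (piOneMap (incl A) ⟨a, ha⟩ α) := by
    obtain ⟨r, rfl⟩ := loopClass_surjective _ α
    exact piOneMap_changeBase (glueToX U V B) (q.map (glueInr U V B).continuous) _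
  rw [hσp, hσq, changeBase_eq_conj]

section Hom

variable {A B : Set X} {b a : X} {G : Type*} [Group G] (c : PathCocycle (Glue U V B) G)

theorem hom_theta (hV : b ∈ V) (hAV : A ⊆ V) (ha : a ∈ A) (q : Path (⟨b, hV⟩ : V) ⟨a, hAV ha⟩)
    (α : PiOne A ⟨a, ha⟩) :
    c.hom _ (theta U V B hV hAV ha q α) = c.pull (glueInr U V B) q *
      ((c.pull (glueInr U V B)).pull (.inclusion hAV)).hom _ α *
        (c.pull (glueInr U V B) q)⁻¹ := by
  obtain ⟨r, rfl⟩ := loopClass_surjective _ α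
  exact c.hom_changeBase _ _

theorem hom_thetaHat (hU : b ∈ U) (hV : b ∈ V) (hB : b ∈ B) (hAU : A ⊆ U) (ha : a ∈ A)
    (p : Path (⟨b, hU⟩ : U) ⟨a, hAU ha⟩) (α : PiOne A ⟨a, ha⟩) :
    c.hom _ (thetaHat U V B hU hV hB hAU ha p α) = c.pull (glueInl U V B) p *
      ((c.pull (glueInl U V B)).pull (.inclusion hAU)).hom _ α *
        (c.pull (glueInl U V B) p)⁻¹ := by
  obtain ⟨r, rfl⟩ := loopClass_surjective _ α
  exact c.hom_changeBase _ _

end Hom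

section Crossing

variable {ι G : Type*} [Group G] {a : Option ι → X} (ha : ∀ i, a i ∈ U ∩ V)
  (p : ∀ k : ι, Path (⟨a none, (ha none).1⟩ : U) ⟨a (some k), (ha (some k)).1⟩)
  (q : ∀ k : ι, Path (⟨a none, (ha none).2⟩ : V) ⟨a (some k), (ha (some k)).2⟩)

/-- The class of the loop `p k · (q k)⁻¹`, which passes from `U` to `V` at the point `a (some k)`;
the isomorphism of the theorem maps the free generator `t k` to it. -/
def crossing (k : ι) : PiOne X (a none) :=
  loopClass (((p k).map continuous_subtype_val).trans ((q k).map continuous_subtype_val).symm)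

theorem hom_crossing (c : PathCocycle X G) (k : ι) :
    c.hom (a none) (crossing ha p q k) = c.pull (incl U) (p k) * (c.pull (incl V) (q k))⁻¹ := by
  rw [crossing, c.hom_loopClass, c.map_trans, c.map_symm]
  rfl

theorem exists_twist_eq_of_relations
    (hA_inj : Injective fun i => comp U V (a i)) (hA_cover : ⋃ i, comp U V (a i) = U ∩ V)
    (c : PathCocycle (Glue U V (comp U V (a none))) G) (τ : ι → G)
    (hτ : ∀ k α, c.hom _ (thetaHat U V (comp U V (a none)) (ha none).1 (ha none).2
        (mem_comp (ha none)) comp_subset_left (mem_comp (ha (some k))) (p k) α) =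
      τ k * c.hom _ (theta U V (comp U V (a none)) (ha none).2 comp_subset_right
        (mem_comp (ha (some k))) (q k) α) * (τ k)⁻¹) :
    ∃ δ : ↥(U ∩ V) → G, δ ⟨a none, ha none⟩ = 1 ∧
      (∀ k, c.pull (glueInl U V _) (p k) * δ ⟨a (some k), ha (some k)⟩ =
        τ k * c.pull (glueInr U V _) (q k)) ∧
      ((c.pull (glueInl U V _)).pull (.inclusion inter_subset_left)).twist δ =
        (c.pull (glueInr U V _)).pull (.inclusion inter_subset_right) := by
  let L : PathCocycle ↥(U ∩ V) G := (c.pull (glueInl U V _)).pull (.inclusion inter_subset_left)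
  let R : PathCocycle ↥(U ∩ V) G := (c.pull (glueInr U V _)).pull (.inclusion inter_subset_right)
  let P (k : ι) : G := c.pull (glueInl U V _) (p k)
  let Q (k : ι) : G := c.pull (glueInr U V _) (q k)
  let g (i : Option ι) : G := i.elim 1 fun k => (P k)⁻¹ * (τ k * Q k)
  have hg (i : Option ι) (r : Path (⟨a i, ha i⟩ : ↥(U ∩ V)) ⟨a i, ha i⟩) :
      L r * g i = g i * R r := by
    obtain ⟨r', hr⟩ := exists_eq_map_inclusion r
    cases i with
    | none =>
      have hLR : L r = R r := by
        subst hr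
        exact congr(($(pull_glueInl_comp_inclusion c comp_subset_left comp_subset_right)).toFun r')
      exact (mul_one _).trans (hLR.trans (one_mul _).symm)
    | some k =>
      have hLR : P k * L r * (P k)⁻¹ = τ k * (Q k * R r * (Q k)⁻¹) * (τ k)⁻¹ := by
        have h := hτ k (loopClass r')
        rw [hom_thetaHat, hom_theta] at h
        subst hr
        exact h
      calc L r * ((P k)⁻¹ * (τ k * Q k))
          = (P k)⁻¹ * (P k * L r * (P k)⁻¹) * (τ k * Q k) := by group
        _ = (P k)⁻¹ * (τ k * Q k) * R r := by rw [hLR]; group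
  obtain ⟨δ, hδ, htwist⟩ := PathCocycle.exists_twist_eq
    (existsUnique_joined (a := fun i => ⟨a i, ha i⟩) hA_inj hA_cover) L R g hg
  exact ⟨δ, hδ none, fun k => (congrArg _ (hδ (some k))).trans (mul_inv_cancel_left _ _), htwist⟩

theorem exists_hom_of_relations (hUo : IsOpen U) (hVo : IsOpen V) (hU : IsPathConnected U)
    (hV : IsPathConnected V) (hUV : U ∪ V = univ) (hA_inj : Injective fun i => comp U V (a i))
    (hA_cover : ⋃ i, comp U V (a i) = U ∩ V) (hA₀ : IsOpenAlongPaths (comp U V (a none)))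
    (π : PiOne (Glue U V (comp U V (a none)))
      (glueInr U V _ ⟨a none, (ha none).2⟩) →* G) (τ : ι → G)
    (hτ : ∀ k α, π (thetaHat U V (comp U V (a none)) (ha none).1 (ha none).2 (mem_comp (ha none))
        comp_subset_left (mem_comp (ha (some k))) (p k) α) =
      τ k * π (theta U V (comp U V (a none)) (ha none).2 comp_subset_right
        (mem_comp (ha (some k))) (q k) α) * (τ k)⁻¹) :
    ∃ Ψ : PiOne X (a none) →* G, (∀ γ, Ψ (sigmaStar U V _ (ha none).2 γ) = π γ) ∧
      ∀ k, Ψ (crossing ha p q k) = τ k := by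
  classical
  have := pathConnectedSpace_glue hU hV (ha none).1 (ha none).2 (mem_comp (ha none))
  obtain ⟨c, rfl⟩ := PathCocycle.exists_hom_eq _ π
  obtain ⟨δ, hδ₀, hδp, hδ⟩ := exists_twist_eq_of_relations ha p q hA_inj hA_cover c τ hτ
  let δU (u : U) : G := if hu : ↑u ∈ V then δ ⟨u, u.2, hu⟩ else 1
  have hδU (x : ↥(U ∩ V)) : δU ⟨x, x.2.1⟩ = δ x := dif_pos x.2.2
  obtain ⟨ε, hεU, hεV⟩ := exists_fun_glue (B := comp U V (a none)) δU (1 : V → G)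
    fun x hxU hxV hx => (hδU ⟨x, hxU, hxV⟩).trans <| twist_eq_one_of_isPathConnected hδ
      (isPathConnected_pathComponentIn (ha none)) pathComponentIn_subset
      (mem_comp (ha none)) hx hδ₀
  have htU : (c.twist ε).pull (glueInl U V _) = (c.pull (glueInl U V _)).twist δU :=
    congrArg (c.pull (glueInl U V _)).twist hεU
  have htV : (c.twist ε).pull (glueInr U V _) = c.pull (glueInr U V _) :=
    (congrArg (c.pull (glueInr U V _)).twist hεV).trans (PathCocycle.twist_one _)
  obtain ⟨d, hd⟩ := hA₀.exists_pull_glueToX_eq comp_subset_left comp_subset_right hUo hVo hUV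
    (c.twist ε) <| by
      rw [htU, htV, ← hδ]
      exact congrArg ((c.pull (glueInl U V _)).pull (.inclusion inter_subset_left)).twist
        (funext hδU)
  have hdU : d.pull (incl U) = (c.pull (glueInl U V _)).twist δU :=
    (congrArg (PathCocycle.pull · (glueInl U V _)) hd).trans htU
  have hdV : d.pull (incl V) = c.pull (glueInr U V _) :=
    (congrArg (PathCocycle.pull · (glueInr U V _)) hd).trans htV
  refine ⟨d.hom _, fun γ => ?_, fun k => ?_⟩
  · refine (d.hom_piOneMap (glueToX U V _) _ γ).trans ?_
    rw [hd, c.hom_twist (congrFun hεV _)]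
  · rw [hom_crossing, hdU, hdV, PathCocycle.twist_apply, hδU ⟨_, ha none⟩, hδ₀,
      hδU ⟨_, ha (some k)⟩, inv_one, one_mul, hδp, mul_inv_cancel_right]

theorem twist_eqOn_inter_of_crossing (hA_cover : ⋃ i, comp U V (a i) = U ∩ V)
    {c d : PathCocycle X G} {u : U → G} {v : V → G}
    (hu : (c.pull (incl U)).twist u = d.pull (incl U))
    (hv : (c.pull (incl V)).twist v = d.pull (incl V))
    (hu₀ : u ⟨a none, (ha none).1⟩ = 1) (hv₀ : v ⟨a none, (ha none).2⟩ = 1)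
    (hcrossing : ∀ k, c.hom (a none) (crossing ha p q k) = d.hom (a none) (crossing ha p q k))
    {x : X} (hxU : x ∈ U) (hxV : x ∈ V) : u ⟨x, hxU⟩ = v ⟨x, hxV⟩ := by
  have huv (i : Option ι) : u ⟨a i, (ha i).1⟩ = v ⟨a i, (ha i).2⟩ := by
    cases i with
    | none => exact hu₀.trans hv₀.symm
    | some k =>
      have h := hcrossing k
      rw [hom_crossing, hom_crossing, ← hu, ← hv, PathCocycle.twist_apply,
        PathCocycle.twist_apply, hu₀, hv₀] at h
      rw [inv_one, one_mul, one_mul, mul_inv_rev, mul_assoc, mul_right_inj, ← mul_assoc,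
        right_eq_mul, mul_inv_eq_one] at h
      exact h
  have hinter : ((c.pull (incl (U ∩ V))).twist fun y => u ⟨y, y.2.1⟩) = d.pull (incl (U ∩ V)) :=
    congrArg (PathCocycle.pull · (.inclusion inter_subset_left)) hu
  have hinter' : ((c.pull (incl (U ∩ V))).twist fun y => v ⟨y, y.2.2⟩) = d.pull (incl (U ∩ V)) :=
    congrArg (PathCocycle.pull · (.inclusion inter_subset_right)) hv
  obtain ⟨i, hi⟩ := mem_iUnion.1 (hA_cover.symm ▸ ⟨hxU, hxV⟩ : x ∈ ⋃ i, comp U V (a i))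
  exact PathCocycle.eq_of_twist_eq hinter hinter' (x := ⟨a i, ha i⟩) (y := ⟨x, hxU, hxV⟩)
    (joined_iff_mem_pathComponentIn.2 hi) (huv i)

theorem hom_ext_of_crossing (hUo : IsOpen U) (hVo : IsOpen V) (hU : IsPathConnected U)
    (hV : IsPathConnected V) (hUV : U ∪ V = univ) (hA_cover : ⋃ i, comp U V (a i) = U ∩ V)
    {φ ψ : PiOne X (a none) →* G}
    (hσ : ∀ γ, φ (sigmaStar U V (comp U V (a none)) (ha none).2 γ) =
      ψ (sigmaStar U V (comp U V (a none)) (ha none).2 γ))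
    (hcrossing : ∀ k, φ (crossing ha p q k) = ψ (crossing ha p q k)) : φ = ψ := by
  have := pathConnectedSpace_of_union hU hV hUV (ha none)
  have := pathConnectedSpace_glue hU hV (ha none).1 (ha none).2 (mem_comp (ha none))
  obtain ⟨c, rfl⟩ := PathCocycle.exists_hom_eq _ φ
  obtain ⟨d, rfl⟩ := PathCocycle.exists_hom_eq _ ψ
  let b := glueInr U V (comp U V (a none)) ⟨a none, (ha none).2⟩
  have hσ' : (c.pull (glueToX U V _)).hom b = (d.pull (glueToX U V _)).hom b := by
    ext γ
    exact (c.hom_piOneMap (glueToX U V _) b γ).symm.trans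
      ((hσ γ).trans (d.hom_piOneMap (glueToX U V _) b γ))
  obtain ⟨e, heb, he⟩ := PathCocycle.exists_twist_eq_of_hom_eq hσ'
  have heU : (c.pull (incl U)).twist (e ∘ glueInl U V _) = d.pull (incl U) :=
    congrArg (PathCocycle.pull · (glueInl U V _)) he
  have heV : (c.pull (incl V)).twist (e ∘ glueInr U V _) = d.pull (incl V) :=
    congrArg (PathCocycle.pull · (glueInr U V _)) he
  obtain ⟨ε, rfl⟩ := exists_eq_comp_glueToX e fun x hxU hxV =>
    twist_eqOn_inter_of_crossing ha p q hA_cover heU heV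
      ((congrArg e (glueInl_eq_glueInr _ _ (mem_comp (ha none))).symm).trans heb) heb
      hcrossing hxU hxV
  have hcd : c.twist ε = d := PathCocycle.eq_of_pull_eq (j₁ := incl U) (j₂ := incl V)
    IsInducing.subtypeVal IsInducing.subtypeVal (by simpa using hUV)
    (fun f => by simpa using hUo.preimage f.continuous)
    (fun f => by simpa using hVo.preimage f.continuous) heU heV
  rw [← hcd]
  exact (c.hom_twist (b := a none) heb).symm

end Crossing

end VanKampen

end VanKampen

end

open VanKampen in
theorem mainTheorem3_general {X : Type*} [TopologicalSpace X] {U V : Set X}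
    (hUo : IsOpen U) (hVo : IsOpen V)
    (hU : IsPathConnected U) (hV : IsPathConnected V) (hUV : U ∪ V = Set.univ)
    {ι : Type*} (a : Option ι → X) (ha : ∀ i, a i ∈ U ∩ V)
    (hA_inj : Function.Injective fun i => comp U V (a i))
    (hA_cover : ⋃ i, comp U V (a i) = U ∩ V)
    (hA₀ : IsOpenAlongPaths (comp U V (a none)))
    (p : ∀ k : ι, Path (⟨a none, (ha none).1⟩ : U) ⟨a (some k), (ha (some k)).1⟩)
    (q : ∀ k : ι, Path (⟨a none, (ha none).2⟩ : V) ⟨a (some k), (ha (some k)).2⟩) :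
    ∃ Φ : HNNQuotient
        (fun k : ι => thetaHat U V (comp U V (a none)) (ha none).1 (ha none).2
          (mem_comp (ha none)) comp_subset_left (mem_comp (ha (some k))) (p k))
        (fun k : ι => theta U V (comp U V (a none)) (ha none).2
          comp_subset_right (mem_comp (ha (some k))) (q k))
        ≃* PiOne X (a none),
      (∀ γ, Φ (HNNQuotient.proj (Monoid.Coprod.inl γ)) =
        sigmaStar U V (comp U V (a none)) (ha none).2 γ) ∧
      ∀ k, Φ (HNNQuotient.proj (Monoid.Coprod.inr (FreeGroup.of k))) = crossing ha p q k := by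
  obtain ⟨Ψ, hΨσ, hΨcrossing⟩ := exists_hom_of_relations ha p q hUo hVo hU hV hUV
    hA_inj hA_cover hA₀ (HNNQuotient.proj.comp Monoid.Coprod.inl)
    (fun k => HNNQuotient.proj (Monoid.Coprod.inr (FreeGroup.of k))) HNNQuotient.proj_relation
  exact HNNQuotient.exists_mulEquiv
    (fun k α => sigmaStar_thetaHat (ha none).1 (ha none).2 (mem_comp (ha none)) comp_subset_left
      comp_subset_right (mem_comp (ha (some k))) (p k) (q k) α)
    (fun _ hσ hcrossing => hom_ext_of_crossing ha p q hUo hVo hU hV hUV hA_cover hσ hcrossing)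
    hΨσ hΨcrossing

theorem mainTheorem3 {X : Type*} [TopologicalSpace X] {U V : Set X}
    (hUo : IsOpen U) (hVo : IsOpen V)
    (hU : IsPathConnected U) (hV : IsPathConnected V) (hUV : U ∪ V = Set.univ)
    -- the path components `A i = comp U V (a i)`, `i = 0, …, m`, of `U ∩ V`, each listed once,
    -- with a point `a i` in each; the base point is `b = a 0`
    {m : ℕ} (a : Fin (m + 1) → X) (ha : ∀ i, a i ∈ U ∩ V)
    (hA_inj : Function.Injective fun i => VanKampen.comp U V (a i))
    (hA_cover : ⋃ i, VanKampen.comp U V (a i) = U ∩ V)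
    (hA₀ : IsOpen (VanKampen.comp U V (a 0)) ∨ T2Space X)
    -- paths `p k` in `U` and `q k` in `V` from `b` to the points `a 1, …, a m`
    (p : ∀ k : Fin m, Path (⟨a 0, (ha 0).1⟩ : U) ⟨a k.succ, (ha k.succ).1⟩)
    (q : ∀ k : Fin m, Path (⟨a 0, (ha 0).2⟩ : V) ⟨a k.succ, (ha k.succ).2⟩) :
    ∃ Φ : VanKampen.HNNQuotient
        (fun k : Fin m => VanKampen.thetaHat U V (VanKampen.comp U V (a 0))
          (ha 0).1 (ha 0).2 (VanKampen.mem_comp (ha 0))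
          VanKampen.comp_subset_left (VanKampen.mem_comp (ha k.succ)) (p k))
        (fun k : Fin m => VanKampen.theta U V (VanKampen.comp U V (a 0))
          (ha 0).2
          VanKampen.comp_subset_right (VanKampen.mem_comp (ha k.succ)) (q k))
        ≃* VanKampen.PiOne X (a 0),
      (∀ γ, Φ (VanKampen.HNNQuotient.proj (Monoid.Coprod.inl γ)) =
        VanKampen.sigmaStar U V (VanKampen.comp U V (a 0)) (ha 0).2 γ) ∧
      ∀ k : Fin m,
        Φ (VanKampen.HNNQuotient.proj (Monoid.Coprod.inr (FreeGroup.of k))) =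
          VanKampen.loopClass
            (((p k).map continuous_subtype_val).trans
              ((q k).map continuous_subtype_val).symm) := by
  have hbij : Function.Bijective fun i : Option (Fin m) => i.elim 0 Fin.succ := by
    convert (finSuccEquiv m).symm.bijective using 2 with i
    cases i <;> simp
  exact mainTheorem3_general hUo hVo hU hV hUV (fun i => a (i.elim 0 Fin.succ)) (fun i => ha _)
    (hA_inj.comp hbij.1) ((hbij.2.iUnion_comp fun i => VanKampen.comp U V (a i)).trans hA_cover)
    (hA₀.elim VanKampen.isOpenAlongPaths_of_isOpen
      fun _ => VanKampen.isOpenAlongPaths_pathComponentIn (hUo.inter hVo) _) p q
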